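/- Let $\mathrm{FI}$ be the category of finite sets and injections, and $\mathrm{FI}^{O}$ the category of totally ordered finite sets and order-preserving injections; let $\mathcal C$ be one of the two. Let $K$ be a field. A $\mathcal C$-algebra over $K$ is a functor $\mathbf A$, $S\mapsto \mathbf A_S$, from $\mathcal C$ to commutative $K$-algebras with $\mathbf A_\emptyset=K$; an $\mathbf A$-module is a functor $\mathbf M$ from $\mathcal C$ to $K$-modules such that each $\mathbf M_S$ is an $\mathbf A_S$-module and $\mathbf M(\varepsilon)(ax)=\mathbf A(\varepsilon)(a)\,\mathbf M(\varepsilon)(x)$ for all $\varepsilon\colon S\to T$ in $\mathcal C$, $a\in\mathbf A_S$, $x\in\mathbf M_S$. It is finitely generated if some finite subset of $\coprod_{n\ge 0}\mathbf M_{[n]}$ is contained in no proper submodule, and noetherian if all its submodules are finitely generated. Suppose that $\mathbf A$ is standard graded: every $\mathbf A_S=\bigoplus_{d\ge 0}\mathbf A_{S,d}$ is a finitely generated graded $K$-algebra with $\mathbf A_{S,0}=K$, generated in degree $1$, and all maps $\mathbf A(\varepsilon)$ are homogeneous of degree $0$. Suppose also that the category of $\mathbf A$-modules is noetherian, i.e.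 every finitely generated $\mathbf A$-module is noetherian (so that, in particular, $\mathbf A$ is noetherian). Let $\mathbf M$ be a finitely generated $\mathbb Z$-graded $\mathbf A$-module, that is, each $\mathbf M_S$ is a $\mathbb Z$-graded $\mathbf A_S$-module and all maps $\mathbf M(\varepsilon)$ are homogeneous of degree $0$. Put $\mathfrak m_S=\bigoplus_{d\ge 1}\mathbf A_{S,d}$, let $\mathbf K$ be the $\mathbf A$-module $S\mapsto \mathbf A_S/\mathfrak m_S\cong K$ concentrated in degree $0$, and let $\beta_{S,p,j}(\mathbf M)=\dim_K\bigl(\operatorname{Tor}^{\mathbf A}_p(\mathbf M,\mathbf K)_S\bigr)_j$, where $\operatorname{Tor}^{\mathbf A}_p(-,\mathbf K)$ are the left derived functors of the componentwise tensor product $(\mathbf M\otimes_{\mathbf A}\mathbf K)_S=\mathbf M_S\otimes_{\mathbf A_S}\mathbf K_S$. Then for every integer $p\ge 0$ the set $$D_p=\{\,j\in\mathbb Z : \beta_{S,p,j}(\mathbf M)\ne 0 \text{ for some object } S \text{ of } \mathcal C\,\}$$ is bounded below and above; in particular, if it is nonempty, it has a largest element $m(\mathbf M,p)<\infty$. Moreover,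 there is a finite (possibly empty) set of integers $j_0<\dots<j_t$, all at most $m(\mathbf M,p)$, and an integer $n$ such that for every object $S$ of $\mathcal C$ with $|S|\ge n$ and every $j\in\mathbb Z$, $$\beta_{S,p,j}(\mathbf M)\neq 0\quad\text{if and only if}\quad j\in\{j_0,\dots,j_t\}.$$ -/

import Mathlib

open CategoryTheory
open scoped TensorProduct

universe u

namespace FinInj

/-! ## The categories of finite sets with injections and their ordered variant -/

/-- Objects of the category `FI`: finite sets. -/
structure FI : Type 1 where
  carrier : Type
  [finite : Finite carrier]

attribute [instance] FI.finite

/-- Morphisms of `FI` are the injections. -/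
instance : Category.{0} FI where
  Hom S T := S.carrier ↪ T.carrier
  id S := Function.Embedding.refl S.carrier
  comp f g := f.trans g

/-- Objects of the category `OI` (also written `FI^O`): totally ordered finite sets. -/
structure OI : Type 1 where
  carrier : Type
  [finite : Finite carrier]
  [order : LinearOrder carrier]

attribute [instance] OI.finite OI.order

/-- Morphisms of `OI` are the order-preserving injections. For linear orders these are
exactly the order embeddings. -/
instance : Category.{0} OI where
  Hom S T := S.carrier ↪o T.carrier
  id S := RelEmbedding.refl _
  comp f g := RelEmbedding.trans f g

/-- The data needed to treat `FI` and `OI` simultaneously: the cardinality `card S` of an object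
and the standard object `std n = [n]` with `n` elements. -/
class FinSetCategory (C : Type 1) [Category.{0} C] where
  card : C → ℕ
  std : ℕ → C
  exists_iso : ∀ S : C, Nonempty (std (card S) ≅ S)

noncomputable instance : FinSetCategory FI where
  card S := Nat.card S.carrier
  std n := ⟨Fin n⟩
  exists_iso S := by
    have e : Fin (Nat.card S.carrier) ≃ S.carrier := (Finite.equivFin S.carrier).symm
    exact ⟨⟨e.toEmbedding, e.symm.toEmbedding, Function.Embedding.ext fun x => e.symm_apply_apply x,
      Function.Embedding.ext fun x => e.apply_symm_apply x⟩⟩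

noncomputable instance : FinSetCategory OI where
  card S := Nat.card S.carrier
  std n := ⟨Fin n⟩
  exists_iso S := by
    have := Fintype.ofFinite S.carrier
    have e : Fin (Nat.card S.carrier) ≃o S.carrier :=
      Fintype.orderIsoFinOfCardEq S.carrier Nat.card_eq_fintype_card.symm
    exact ⟨⟨e.toOrderEmbedding, e.symm.toOrderEmbedding,
      RelEmbedding.ext fun x => e.symm_apply_apply x,
      RelEmbedding.ext fun x => e.apply_symm_apply x⟩⟩

/-! ## Algebras and modules -/

/-- An `FI`-algebra (for `C = FI`) or `OI`-algebra (for `C = OI`) over `K`: a functor from `C`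
to commutative `K`-algebras whose value at the empty set is `K`. -/
structure Alg (C : Type 1) [Category.{0} C] [FinSetCategory C] (K : Type u) [CommRing K] where
  functor : C ⥤ CommAlgCat.{u} K
  bijective_algebraMap_empty : ∀ S : C, FinSetCategory.card S = 0 →
    Function.Bijective (algebraMap K (functor.obj S))

section

variable {C : Type 1} [Category.{0} C] [FinSetCategory C] {K : Type u}

/-- The commutative `K`-algebra `A_S`. -/
abbrev Alg.obj [CommRing K] (A : Alg C K) (S : C) : Type u := A.functor.obj S

/-- The `K`-algebra homomorphism `ε^* : A_S → A_T` induced by `ε : S → T`. -/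
abbrev Alg.map [CommRing K] (A : Alg C K) {S T : C} (ε : S ⟶ T) : A.obj S →ₐ[K] A.obj T :=
  (A.functor.map ε).hom

/-- A module over the `FI`- (or `OI`-) algebra `A`: a functor `M` from `C` to `K`-modules together
with an `A_S`-module structure on each `M_S`, compatible with the maps `M(ε)`. -/
structure Mod [CommRing K] (A : Alg C K) where
  obj : C → Type u
  [addCommGroup : ∀ S, AddCommGroup (obj S)]
  [moduleBase : ∀ S, Module K (obj S)]
  [module : ∀ S, Module (A.obj S) (obj S)]
  [isScalarTower : ∀ S, IsScalarTower K (A.obj S) (obj S)]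
  map : ∀ {S T : C}, (S ⟶ T) → obj S →ₗ[K] obj T
  map_id : ∀ (S : C) (x : obj S), map (𝟙 S) x = x
  map_comp : ∀ {S T U : C} (ε : S ⟶ T) (δ : T ⟶ U) (x : obj S), map (ε ≫ δ) x = map δ (map ε x)
  map_smul : ∀ {S T : C} (ε : S ⟶ T) (a : A.obj S) (x : obj S), map ε (a • x) = A.map ε a • map ε x

attribute [instance] Mod.addCommGroup Mod.moduleBase Mod.module Mod.isScalarTower

/-- A submodule of `M`: submodules `N_S ⊆ M_S` which are preserved by all maps `M(ε)`. -/
structure SubMod [CommRing K] {A : Alg C K} (M : Mod A) where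
  carrier : ∀ S, Submodule (A.obj S) (M.obj S)
  map_mem : ∀ {S T : C} (ε : S ⟶ T) (x : M.obj S), x ∈ carrier S → M.map ε x ∈ carrier T

/-- The submodule `N` is finitely generated: there are finitely many elements `q i ∈ N_[n i]` such
that every submodule containing all of them contains `N`. -/
def SubMod.FG [CommRing K] {A : Alg C K} {M : Mod A} (N : SubMod M) : Prop :=
  ∃ (k : ℕ) (n : Fin k → ℕ) (q : ∀ i, M.obj (FinSetCategory.std (n i))),
    (∀ i, q i ∈ N.carrier _) ∧
    ∀ N' : SubMod M, (∀ i, q i ∈ N'.carrier _) → ∀ S, N.carrier S ≤ N'.carrier S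

/-- `M` as a submodule of itself. -/
def SubMod.top [CommRing K] {A : Alg C K} (M : Mod A) : SubMod M where
  carrier _ := ⊤
  map_mem _ _ _ := trivial

/-- `M` is a finitely generated module. -/
def Mod.FG [CommRing K] {A : Alg C K} (M : Mod A) : Prop := (SubMod.top M).FG

/-- `M` is a noetherian module: all its submodules are finitely generated. -/
def Mod.Noetherian [CommRing K] {A : Alg C K} (M : Mod A) : Prop := ∀ N : SubMod M, N.FG

/-- The category of modules over `A` is noetherian: every finitely generated module over `A` is
noetherian. (Since `A` is a finitely generated module over itself, `A` is then a noetherian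
algebra.) -/
def Alg.NoetherianModules [CommRing K] (A : Alg C K) : Prop := ∀ M : Mod A, M.FG → M.Noetherian

/-! ## Gradings -/

/-- A standard grading on `A`: each `A_S` is a `ℤ`-graded `K`-algebra, concentrated in nonnegative
degrees, with degree zero part `K`, generated by its elements of degree one and finitely generated;
all maps `A(ε)` are homogeneous of degree zero. -/
structure StandardGrading [Field K] (A : Alg C K) where
  deg : ∀ S, ℤ → Submodule K (A.obj S)
  [graded : ∀ S, GradedAlgebra (deg S)]
  deg_neg : ∀ S (d : ℤ), d < 0 → deg S d = ⊥
  deg_zero : ∀ S, deg S 0 = LinearMap.range (Algebra.linearMap K (A.obj S))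
  algebraMap_injective : ∀ S, Function.Injective (algebraMap K (A.obj S))
  adjoin_deg_one : ∀ S, Algebra.adjoin K (deg S 1 : Set (A.obj S)) = ⊤
  finiteType : ∀ S, Algebra.FiniteType K (A.obj S)
  map_mem : ∀ {S T : C} (ε : S ⟶ T) (d : ℤ) (a : A.obj S), a ∈ deg S d → A.map ε a ∈ deg T d

attribute [instance] StandardGrading.graded

variable [Field K] {A : Alg C K}

/-- The graded maximal ideal `𝔪_S = ⊕_{d ≥ 1} A_{S,d}` of `A_S`. -/
def StandardGrading.maxIdeal (𝒜 : StandardGrading A) (S : C) : Ideal (A.obj S) :=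
  Ideal.span {a | ∃ d : ℤ, 1 ≤ d ∧ a ∈ 𝒜.deg S d}

/-- A `ℤ`-graded module over the standard graded algebra `A`. -/
structure GrMod (𝒜 : StandardGrading A) extends Mod A where
  deg : ∀ S, ℤ → Submodule K (obj S)
  isInternal : ∀ S, DirectSum.IsInternal (deg S)
  smul_mem : ∀ (S : C) (i j : ℤ) (a : A.obj S) (x : obj S),
    a ∈ 𝒜.deg S i → x ∈ deg S j → a • x ∈ deg S (i + j)
  map_mem : ∀ {S T : C} (ε : S ⟶ T) (j : ℤ) (x : obj S), x ∈ deg S j → map ε x ∈ deg T j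

variable {𝒜 : StandardGrading A}

/-- Morphisms of graded modules, homogeneous of degree zero. -/
structure GrHom (M N : GrMod 𝒜) where
  app : ∀ S, M.obj S →ₗ[A.obj S] N.obj S
  naturality : ∀ {S T : C} (ε : S ⟶ T) (x : M.obj S), app T (M.map ε x) = N.map ε (app S x)
  map_mem : ∀ (S : C) (j : ℤ) (x : M.obj S), x ∈ M.deg S j → app S x ∈ N.deg S j

/-- `F` is a graded free module, that is, isomorphic to a direct sum of shifted copies of the free
modules `F^{(n)}`, where `F^{(n)}_S` is the free `A_S`-module on `Hom([n], S)`. Equivalently, there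
are homogeneous elements `e l ∈ F_[n l]` such that for each `S` the family of all `F(π)(e l)`, where
`π : [n l] → S`, is a basis of the `A_S`-module `F_S`. -/
def GrMod.IsFree (F : GrMod 𝒜) : Prop :=
  ∃ (Λ : Type u) (n : Λ → ℕ) (a : Λ → ℤ) (e : ∀ l, F.obj (FinSetCategory.std (n l))),
    (∀ l, e l ∈ F.deg _ (a l)) ∧
    ∀ S : C, ∃ b : Module.Basis (Σ l : Λ, (FinSetCategory.std (n l) ⟶ S)) (A.obj S) (F.obj S),
      ∀ l π, b ⟨l, π⟩ = F.map π (e l)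

/-- A graded free resolution `⋯ → F 1 → F 0 → M → 0` of the graded module `M`. -/
structure GrResolution (M : GrMod 𝒜) where
  F : ℕ → GrMod 𝒜
  isFree : ∀ p, (F p).IsFree
  d : ∀ p, GrHom (F (p + 1)) (F p)
  aug : GrHom (F 0) M
  aug_surjective : ∀ S, Function.Surjective (aug.app S)
  exact_zero : ∀ S, Function.Exact ((d 0).app S) (aug.app S)
  exact_succ : ∀ p S, Function.Exact ((d (p + 1)).app S) ((d p).app S)

/-! ## Existence of graded free resolutions -/

/-- The homogeneous elements of the modules `M_[n]`. -/
abbrev GrMod.Index (M : GrMod 𝒜) : Type u :=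
  Σ (n : ℕ) (a : ℤ), M.deg (FinSetCategory.std n) a

/-- The index set of the basis of the free cover of `M` at `S`. -/
abbrev GrMod.BasisIndex (M : GrMod 𝒜) (S : C) : Type u :=
  Σ l : M.Index, (FinSetCategory.std l.1 ⟶ S)

/-- The map of the free cover induced by `ε : S → T`: it maps `a e_π` to `ε^*(a) e_{ε ∘ π}`. -/
noncomputable def GrMod.freeMap (M : GrMod 𝒜) {S T : C} (ε : S ⟶ T) :
    (M.BasisIndex S →₀ A.obj S) →ₗ[K] (M.BasisIndex T →₀ A.obj T) :=
  (Finsupp.lmapDomain (A.obj T) K fun b : M.BasisIndex S => (⟨b.1, b.2 ≫ ε⟩ : M.BasisIndex T)) ∘ₗ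
    Finsupp.mapRange.linearMap (A.map ε).toLinearMap

@[simp]
lemma GrMod.freeMap_single (M : GrMod 𝒜) {S T : C} (ε : S ⟶ T) (b : M.BasisIndex S)
    (a : A.obj S) : M.freeMap ε (Finsupp.single b a) =
      Finsupp.single (⟨b.1, b.2 ≫ ε⟩ : M.BasisIndex T) (A.map ε a) := by
  simp [GrMod.freeMap]

/-- The degree `j` part of the free cover of `M` at `S`, where `e_π` has the degree of the
homogeneous element indexing it. -/
def GrMod.freeDeg (M : GrMod 𝒜) (S : C) (j : ℤ) : Submodule K (M.BasisIndex S →₀ A.obj S) where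
  carrier := {f | ∀ b, f b ∈ 𝒜.deg S (j - b.1.2.1)}
  add_mem' hf hg b := Submodule.add_mem _ (hf b) (hg b)
  zero_mem' _ := Submodule.zero_mem _
  smul_mem' c _ hf b := Submodule.smul_mem _ c (hf b)

lemma GrMod.single_mem_freeDeg (M : GrMod 𝒜) (S : C) (i : ℤ) (b : M.BasisIndex S) (a : A.obj S)
    (ha : a ∈ 𝒜.deg S i) : Finsupp.single b a ∈ M.freeDeg S (i + b.1.2.1) := by
  classical
  intro b'
  by_cases h : b = b'
  · subst h
    simpa using ha
  · simp [h]

/-- A family of submodules is a direct sum decomposition as soon as it spans and has a family of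
projections. -/
lemma isInternal_of_proj {R V : Type*} [Ring R] [AddCommGroup V] [Module R V]
    (D : ℤ → Submodule R V) (proj : ℤ → V →+ V)
    (h_self : ∀ j, ∀ x ∈ D j, proj j x = x)
    (h_ne : ∀ i j, i ≠ j → ∀ x ∈ D i, proj j x = 0)
    (h_span : ∀ x, x ∈ ⨆ j, D j) : DirectSum.IsInternal D := by
  classical
  rw [DirectSum.isInternal_submodule_iff_iSupIndep_and_iSup_eq_top]
  refine ⟨?_, eq_top_iff.2 fun x _ => h_span x⟩
  intro j
  rw [Submodule.disjoint_def]
  intro x hx hx'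
  have key : ∀ y ∈ ⨆ i, ⨆ (_ : i ≠ j), D i, proj j y = 0 := by
    intro y hy
    induction hy using Submodule.iSup_induction' with
    | mem i y hy =>
      by_cases hij : i = j
      · subst hij
        simp only [ne_eq, not_true_eq_false, iSup_false] at hy
        rw [(Submodule.mem_bot R).1 hy, map_zero]
      · simp only [ne_eq, hij, not_false_eq_true, iSup_pos] at hy
        exact h_ne i j hij y hy
    | zero => exact map_zero _
    | add y z _ _ hy hz => rw [map_add, hy, hz, add_zero]
  rw [← h_self j x hx, key x hx']

lemma GrMod.freeDeg_isInternal (M : GrMod 𝒜) (S : C) : DirectSum.IsInternal (M.freeDeg S) := by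
  classical
  let pr : ℤ → A.obj S →+ A.obj S := fun i => GradedRing.proj (𝒜.deg S) i
  let P : ℤ → (M.BasisIndex S →₀ A.obj S) →+ (M.BasisIndex S →₀ A.obj S) := fun j =>
    Finsupp.liftAddHom fun b => (Finsupp.singleAddHom b).comp (pr (j - b.1.2.1))
  have hP : ∀ j f b, P j f b = pr (j - b.1.2.1) (f b) := by
    intro j f b
    induction f using Finsupp.induction_linear with
    | zero => simp
    | add f g hf hg => simp [hf, hg]
    | single b' a =>
      by_cases h : b' = b
      · subst h; simp [P]
      · simp [P, h]
  refine isInternal_of_proj _ P ?_ ?_ ?_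
  · intro j f hf
    ext b
    rw [hP]
    exact DirectSum.decompose_of_mem_same _ (hf b)
  · intro i j hij f hf
    ext b
    rw [hP]
    exact DirectSum.decompose_of_mem_ne _ (hf b) (by simpa using hij)
  · intro f
    induction f using Finsupp.induction_linear with
    | zero => exact Submodule.zero_mem _
    | add f g hf hg => exact Submodule.add_mem _ hf hg
    | single b a =>
      induction a using DirectSum.Decomposition.inductionOn (𝒜.deg S) with
      | zero => simp
      | homogeneous a =>
        exact Submodule.mem_iSup_of_mem _ (M.single_mem_freeDeg S _ b _ a.2)
      | add a a' h h' =>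
        rw [Finsupp.single_add]
        exact Submodule.add_mem _ h h'

/-- The free cover of `M`: the direct sum of the free modules `F^{(n)}`, shifted by `a`, over all
homogeneous elements of degree `a` of the modules `M_[n]`. -/
noncomputable def GrMod.freeCover (M : GrMod 𝒜) : GrMod 𝒜 where
  obj S := M.BasisIndex S →₀ A.obj S
  map ε := M.freeMap ε
  map_id S x := by
    induction x using Finsupp.induction_linear with
    | zero => simp
    | add f g hf hg => rw [map_add, hf, hg]
    | single b a => simp [Alg.map]
  map_comp ε δ x := by
    induction x using Finsupp.induction_linear with
    | zero => simp
    | add f g hf hg => simp only [map_add, hf, hg]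
    | single b a => simp [Alg.map]
  map_smul ε a x := by
    induction x using Finsupp.induction_linear with
    | zero => simp
    | add f g hf hg => simp only [map_add, smul_add, hf, hg]
    | single b a' => simp only [Finsupp.smul_single, GrMod.freeMap_single, smul_eq_mul, map_mul]
  deg := M.freeDeg
  isInternal := M.freeDeg_isInternal
  smul_mem S i j a x ha hx b := by
    have := SetLike.mul_mem_graded ha (hx b)
    rwa [← add_sub_assoc] at this
  map_mem {S T} ε j x hx := by
    have hx' : M.freeMap ε x = x.sum fun b a => M.freeMap ε (Finsupp.single b a) := by
      conv_lhs => rw [← Finsupp.sum_single x]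
      simp only [Finsupp.sum, map_sum]
    rw [hx']
    refine Submodule.sum_mem _ fun b _ => ?_
    have := M.single_mem_freeDeg T (j - b.1.2.1) ⟨b.1, b.2 ≫ ε⟩ _ (𝒜.map_mem ε _ _ (hx b))
    simpa using this

lemma GrMod.freeCover_isFree (M : GrMod 𝒜) : M.freeCover.IsFree := by
  refine ⟨M.Index, fun l => l.1, fun l => l.2.1,
    fun l => (Finsupp.single (⟨l, 𝟙 _⟩ : M.BasisIndex _) (1 : A.obj _)), ?_, ?_⟩
  · intro l
    have := M.single_mem_freeDeg _ 0 ⟨l, 𝟙 _⟩ (1 : A.obj _) SetLike.GradedOne.one_mem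
    rw [zero_add] at this
    exact this
  · intro S
    refine ⟨Module.Basis.ofRepr (LinearEquiv.refl _ _), fun l π => ?_⟩
    change _ = M.freeMap π _
    rw [GrMod.freeMap_single]
    simp
    rfl

/-- The map from the free cover to `M` at `S`, which sends `e_π` to `M(π)(x)` where `x` is the
homogeneous element indexing `e_π`. -/
noncomputable def GrMod.coverApp (M : GrMod 𝒜) (S : C) :
    (M.BasisIndex S →₀ A.obj S) →ₗ[A.obj S] M.obj S :=
  Finsupp.linearCombination (A.obj S) fun b : M.BasisIndex S => M.map b.2 b.1.2.2.1

lemma GrMod.coverApp_single (M : GrMod 𝒜) (S : C) (b : M.BasisIndex S) (a : A.obj S) :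
    M.coverApp S (Finsupp.single b a) = a • M.map b.2 b.1.2.2.1 :=
  Finsupp.linearCombination_single _ _ _

lemma GrMod.coverApp_freeMap (M : GrMod 𝒜) {S T : C} (ε : S ⟶ T)
    (x : M.BasisIndex S →₀ A.obj S) :
    M.coverApp T (M.freeMap ε x) = M.map ε (M.coverApp S x) := by
  induction x using Finsupp.induction_linear with
  | zero => simp
  | add f g hf hg => simp only [map_add, hf, hg]
  | single b a => rw [M.freeMap_single, coverApp_single, coverApp_single, M.map_smul, M.map_comp]

lemma GrMod.coverApp_mem (M : GrMod 𝒜) (S : C) (j : ℤ) (x : M.BasisIndex S →₀ A.obj S)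
    (hx : x ∈ M.freeDeg S j) : M.coverApp S x ∈ M.deg S j := by
  rw [coverApp, Finsupp.linearCombination_apply]
  refine Submodule.sum_mem _ fun b _ => ?_
  have := M.smul_mem S _ _ _ _ (hx b) (M.map_mem b.2 _ _ b.1.2.2.2)
  simpa using this

lemma GrMod.coverApp_surjective (M : GrMod 𝒜) (S : C) : Function.Surjective (M.coverApp S) := by
  rw [← LinearMap.range_eq_top, eq_top_iff]
  intro x _
  have hx : x ∈ ⨆ j, M.deg S j := by
    rw [(M.isInternal S).submodule_iSup_eq_top]; trivial
  induction hx using Submodule.iSup_induction' with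
  | mem j x hx =>
    obtain ⟨e⟩ := FinSetCategory.exists_iso S
    refine ⟨Finsupp.single (⟨⟨FinSetCategory.card S, j, M.map e.inv x, M.map_mem e.inv j x hx⟩,
      e.hom⟩ : M.BasisIndex S) (1 : A.obj S), ?_⟩
    rw [M.coverApp_single, one_smul, ← M.map_comp, e.inv_hom_id, M.map_id]
  | zero => exact Submodule.zero_mem _
  | add x y _ _ hx hy => exact Submodule.add_mem _ (hx trivial) (hy trivial)

/-- The surjection from the free cover onto `M`. -/
noncomputable def GrMod.coverMap (M : GrMod 𝒜) : GrHom M.freeCover M where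
  app := M.coverApp
  naturality := M.coverApp_freeMap
  map_mem := M.coverApp_mem

lemma GrHom.ker_isInternal {M N : GrMod 𝒜} (φ : GrHom M N) (S : C) :
    DirectSum.IsInternal fun j =>
      (M.deg S j).comap ((LinearMap.ker (φ.app S)).restrictScalars K).subtype := by
  classical
  let _ := (M.isInternal S).chooseDecomposition
  let _ := (N.isInternal S).chooseDecomposition
  have hφ : ∀ (j : ℤ) (x : M.obj S), φ.app S (DirectSum.decompose (M.deg S) x j) =
      DirectSum.decompose (N.deg S) (φ.app S x) j := by
    intro j x
    induction x using DirectSum.Decomposition.inductionOn (M.deg S) with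
    | zero => simp
    | @homogeneous i x =>
      by_cases hij : i = j
      · subst hij
        rw [DirectSum.decompose_of_mem_same _ x.2,
          DirectSum.decompose_of_mem_same _ (φ.map_mem S _ _ x.2)]
      · rw [DirectSum.decompose_of_mem_ne _ x.2 hij,
          DirectSum.decompose_of_mem_ne _ (φ.map_mem S _ _ x.2) hij, map_zero]
    | add x y hx hy => simp [hx, hy]
  let P : ℤ → (LinearMap.ker (φ.app S)).restrictScalars K →+
      (LinearMap.ker (φ.app S)).restrictScalars K := fun j =>
    { toFun := fun x => ⟨DirectSum.decompose (M.deg S) x.1 j, by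
        change φ.app S _ = 0
        rw [hφ, (x.2 : φ.app S x.1 = 0)]
        simp⟩
      map_zero' := by ext; simp
      map_add' := fun x y => by ext; simp }
  refine isInternal_of_proj _ P ?_ ?_ ?_
  · intro j x hx
    exact Subtype.ext (DirectSum.decompose_of_mem_same _ hx)
  · intro i j hij x hx
    exact Subtype.ext (DirectSum.decompose_of_mem_ne _ hx hij)
  · intro x
    have hx : x = ∑ j ∈ (DirectSum.decompose (M.deg S) x.1).support, P j x := by
      apply Subtype.ext
      rw [Submodule.coe_sum]
      exact (DirectSum.sum_support_decompose (M.deg S) x.1).symm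
    rw [hx]
    refine Submodule.sum_mem _ fun j _ => Submodule.mem_iSup_of_mem j ?_
    exact (DirectSum.decompose (M.deg S) x.1 j).2

/-- The kernel of a morphism of graded modules. -/
noncomputable def GrHom.ker {M N : GrMod 𝒜} (φ : GrHom M N) : GrMod 𝒜 where
  obj S := (LinearMap.ker (φ.app S))
  map {S T} ε := LinearMap.codRestrict ((LinearMap.ker (φ.app T)).restrictScalars K)
    (M.map ε ∘ₗ ((LinearMap.ker (φ.app S)).restrictScalars K).subtype) fun x => by
      change φ.app T (M.map ε x.1) = 0
      rw [φ.naturality, (x.2 : φ.app S x.1 = 0), map_zero]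
  map_id S x := Subtype.ext (M.map_id S x.1)
  map_comp ε δ x := Subtype.ext (M.map_comp ε δ x.1)
  map_smul ε a x := Subtype.ext (M.map_smul ε a x.1)
  deg S j := (M.deg S j).comap ((LinearMap.ker (φ.app S)).restrictScalars K).subtype
  isInternal := φ.ker_isInternal
  smul_mem S i j a x ha hx := M.smul_mem S i j a x.1 ha hx
  map_mem ε j x hx := M.map_mem ε j x.1 hx

/-- The iterated syzygy modules of `M` with respect to free covers. -/
noncomputable def GrMod.syz (M : GrMod 𝒜) : ℕ → GrMod 𝒜
  | 0 => M
  | p + 1 => (M.syz p).coverMap.ker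

/-- The standard graded free resolution of `M`, which is obtained by iterating free covers. -/
noncomputable def GrMod.resolution (M : GrMod 𝒜) : GrResolution M where
  F p := (M.syz p).freeCover
  isFree p := (M.syz p).freeCover_isFree
  d p :=
    { app := fun S => (LinearMap.ker ((M.syz p).coverApp S)).subtype ∘ₗ (M.syz (p + 1)).coverApp S
      naturality := fun ε x => congrArg Subtype.val ((M.syz (p + 1)).coverMap.naturality ε x)
      map_mem := fun S j x hx => (M.syz (p + 1)).coverMap.map_mem S j x hx }
  aug := M.coverMap
  aug_surjective := M.coverApp_surjective
  exact_zero S := by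
    intro x
    constructor
    · intro hx
      obtain ⟨y, hy⟩ := (M.syz 1).coverApp_surjective S ⟨x, hx⟩
      exact ⟨y, congrArg Subtype.val hy⟩
    · rintro ⟨y, rfl⟩
      exact ((M.syz 1).coverApp S y).2
  exact_succ p S := by
    intro x
    constructor
    · intro hx
      obtain ⟨y, hy⟩ := (M.syz (p + 2)).coverApp_surjective S ⟨x, Subtype.ext hx⟩
      exact ⟨y, congrArg Subtype.val hy⟩
    · rintro ⟨y, rfl⟩
      exact congrArg Subtype.val ((M.syz (p + 2)).coverApp S y).2

/-! ## Tor and graded Betti numbers -/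

/-- The residue field `A_S / 𝔪_S ≅ K`, as a module concentrated in degree zero. -/
abbrev StandardGrading.residue (𝒜 : StandardGrading A) (S : C) : Type u :=
  A.obj S ⧸ 𝒜.maxIdeal S

/-- The `A_S`-module `(F ⊗_A 𝐊)_S = F_S ⊗_{A_S} (A_S / 𝔪_S)`. -/
abbrev GrMod.red (F : GrMod 𝒜) (S : C) : Type u := F.obj S ⊗[A.obj S] 𝒜.residue S

/-- The degree `j` part of `F_S ⊗_{A_S} (A_S / 𝔪_S)`, where the second factor is concentrated in
degree zero. -/
def GrMod.redDeg (F : GrMod 𝒜) (S : C) (j : ℤ) : Submodule K (F.red S) :=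
  Submodule.span K {z | ∃ x ∈ F.deg S j, ∃ y : 𝒜.residue S, z = x ⊗ₜ[A.obj S] y}

variable {M : GrMod 𝒜}

/-- The `p`-cycles of the complex `(F ⊗_A 𝐊)_S`. -/
noncomputable def GrResolution.cycles (F : GrResolution M) (S : C) :
    ∀ p : ℕ, Submodule (A.obj S) ((F.F p).red S)
  | 0 => ⊤
  | p + 1 => LinearMap.ker (((F.d p).app S).rTensor (𝒜.residue S))

/-- The `p`-boundaries of the complex `(F ⊗_A 𝐊)_S`. -/
noncomputable def GrResolution.boundaries (F : GrResolution M) (S : C) (p : ℕ) :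
    Submodule (A.obj S) ((F.F p).red S) :=
  LinearMap.range (((F.d p).app S).rTensor (𝒜.residue S))

/-- The homology `H_p((F ⊗_A 𝐊)_S) = Tor_p^A(M, 𝐊)_S`, computed with the resolution `F`. -/
abbrev GrResolution.Tor (F : GrResolution M) (S : C) (p : ℕ) : Type u :=
  F.cycles S p ⧸ (F.boundaries S p).comap (F.cycles S p).subtype

/-- The degree `j` part of `Tor_p^A(M, 𝐊)_S`: the classes of the cycles of degree `j`. -/
noncomputable def GrResolution.torDeg (F : GrResolution M) (S : C) (p : ℕ) (j : ℤ) :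
    Submodule K (F.Tor S p) :=
  (((F.F p).redDeg S j).comap ((F.cycles S p).subtype.restrictScalars K)).map
    (((F.boundaries S p).comap (F.cycles S p).subtype).mkQ.restrictScalars K)

/-- The graded Betti number `β_{S,p,j}(M) = dim_K (Tor_p^A(M, 𝐊)_S)_j`. -/
noncomputable def GrMod.gradedBetti (M : GrMod 𝒜) (S : C) (p : ℕ) (j : ℤ) : Cardinal.{u} :=
  Module.rank K (M.resolution.torDeg S p j)

end

end FinInj

/-!
The graded vector space `Tor_p(M, 𝐊)` is shown to be a finitely generated `A`-module, in a form that
needs no tensor products, and both assertions follow from finite generation alone.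

*From finite generation to the theorem* (`SubMod.FGModRad.exists_degrees`). Let `T = E / 𝔪N` be a
subquotient of a graded module `N` that is generated by finitely many classes. As `𝔪` kills `T` and
`A_S = K + 𝔪_S`, the space `T_S` is spanned over `K` by the images of the generators. So only the
degrees of the components of the generators occur in `T`. Moreover, if all generators live in
sizes at most `n₀` and `n₀ ≤ |S| ≤ |S'|`, then every morphism from the source of a generator to
`S'` factors through `S`; hence `T_{S,j} = 0` implies `T_{S',j} = 0`, and each degree is eventually
present or eventually absent.

*Tor through syzygies* (`GrMod.gradedBetti_ne_zero_iff`). If `Z_p` is the `p`-th syzygy module in the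
resolution by free covers `F_p`, then `Tor_0 = M / 𝔪M` and
`Tor_{p+1} = (Z_{p+1} ∩ 𝔪F_p) / 𝔪Z_{p+1}`.

*Finite generation of Tor.* The free covers are far from finitely generated, and so are the
syzygies `Z_p`. Instead of comparing with a resolution by finitely generated free modules, the
following property is carried along the syzygies (`Mod.Hom.StablyNoeth`): the identity of `Z_p` is
`θ + π χ`, where `θ` is an endomorphism with values in a noetherian submodule and `π : F_p → Z_p` is
the free cover. It holds for `Z_0 = M` with `θ = 1`. It passes to the kernel of a projective cover by
lifting `θ`, the noetherian submodule being lifted by lifting its generators and using that the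
category of `A`-modules is noetherian (`Mod.Hom.StablyNoeth.exists_ker`). On `Z_{p+1} ∩ 𝔪F_p` the
part that factors through `F_p` takes values in `𝔪Z_{p+1}`, so `Tor_{p+1}` is generated by the
elements of a noetherian submodule (`Mod.Hom.StablyNoeth.fgModRad`). No grading is needed in this
step.
-/

namespace FinInj

variable {C : Type 1} [Category.{0} C] [FinSetCategory C] {K : Type u}

/-! ### Morphisms and submodules of modules over `A` -/

section Ungraded

variable [CommRing K] {A : Alg C K}

/-- Morphisms of `A`-modules: natural families of `A_S`-linear maps. No grading is involved. -/
structure Mod.Hom (M N : Mod A) where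
  app : ∀ S, M.obj S →ₗ[A.obj S] N.obj S
  naturality : ∀ {S T : C} (ε : S ⟶ T) (x : M.obj S), app T (M.map ε x) = N.map ε (app S x)

/-- The composition of two morphisms of `A`-modules. -/
def Mod.Hom.comp {L M N : Mod A} (g : Mod.Hom M N) (f : Mod.Hom L M) : Mod.Hom L N where
  app S := g.app S ∘ₗ f.app S
  naturality ε x := by simp [f.naturality, g.naturality]

/-- The image of a submodule under a morphism. -/
def SubMod.map {M N : Mod A} (f : Mod.Hom M N) (R : SubMod M) : SubMod N where
  carrier S := (R.carrier S).map (f.app S)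
  map_mem := by
    rintro S T ε _ ⟨x, hx, rfl⟩
    exact ⟨M.map ε x, R.map_mem ε x hx, f.naturality ε x⟩

/-- The preimage of a submodule under a morphism. -/
def SubMod.comap {M N : Mod A} (f : Mod.Hom M N) (R : SubMod N) : SubMod M where
  carrier S := (R.carrier S).comap (f.app S)
  map_mem ε x hx := by
    rw [Submodule.mem_comap, f.naturality]
    exact R.map_mem ε _ hx

/-- The intersection of two submodules. -/
def SubMod.inter {M : Mod A} (R R' : SubMod M) : SubMod M where
  carrier S := R.carrier S ⊓ R'.carrier S
  map_mem ε x hx := ⟨R.map_mem ε x hx.1, R'.map_mem ε x hx.2⟩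

/-- The submodule generated by elements `q i ∈ M_[n i]`. -/
def SubMod.closure (M : Mod A) {k : ℕ} {n : Fin k → ℕ}
    (q : ∀ i, M.obj (FinSetCategory.std (n i))) : SubMod M where
  carrier S := ⨅ N : {N : SubMod M // ∀ i, q i ∈ N.carrier _}, N.1.carrier S
  map_mem ε x hx := by
    rw [Submodule.mem_iInf] at hx ⊢
    exact fun N => N.1.map_mem ε x (hx N)

lemma SubMod.mem_closure {M : Mod A} {k : ℕ} {n : Fin k → ℕ}
    (q : ∀ i, M.obj (FinSetCategory.std (n i))) (i : Fin k) :
    q i ∈ (SubMod.closure M q).carrier _ := by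
  rw [SubMod.closure, Submodule.mem_iInf]
  exact fun N => N.2 i

lemma SubMod.closure_le {M : Mod A} {k : ℕ} {n : Fin k → ℕ}
    (q : ∀ i, M.obj (FinSetCategory.std (n i))) (N : SubMod M) (hN : ∀ i, q i ∈ N.carrier _)
    (S : C) : (SubMod.closure M q).carrier S ≤ N.carrier S :=
  iInf_le (fun N : {N : SubMod M // ∀ i, q i ∈ N.carrier _} => N.1.carrier S) ⟨N, hN⟩

/-- A submodule of `M`, regarded as an `A`-module. -/
def SubMod.toMod {M : Mod A} (R : SubMod M) : Mod A where
  obj S := R.carrier S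
  map {S T} ε := LinearMap.codRestrict ((R.carrier T).restrictScalars K)
    (M.map ε ∘ₗ ((R.carrier S).restrictScalars K).subtype) fun x => R.map_mem ε x.1 x.2
  map_id S x := Subtype.ext (M.map_id S x.1)
  map_comp ε δ x := Subtype.ext (M.map_comp ε δ x.1)
  map_smul ε a x := Subtype.ext (M.map_smul ε a x.1)

/-- The inclusion of a submodule. -/
def SubMod.incl {M : Mod A} (R : SubMod M) : Mod.Hom R.toMod M where
  app S := (R.carrier S).subtype
  naturality _ _ := rfl

lemma SubMod.FG.of_comap {M N : Mod A} (f : Mod.Hom M N) (R : SubMod N)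
    (hR : ∀ S, R.carrier S ≤ LinearMap.range (f.app S)) (h : (R.comap f).FG) : R.FG := by
  obtain ⟨k, n, q, hq, hgen⟩ := h
  refine ⟨k, n, fun i => f.app _ (q i), hq, fun N' hN' S x hx => ?_⟩
  obtain ⟨y, rfl⟩ := hR S hx
  exact hgen (N'.comap f) hN' S hx

lemma SubMod.FG.of_map {M N : Mod A} (f : Mod.Hom M N)
    (hf : ∀ S, Function.Injective (f.app S)) (R : SubMod M) (h : (R.map f).FG) : R.FG := by
  obtain ⟨k, n, q, hq, hgen⟩ := h
  choose q' hq' hqq' using hq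
  refine ⟨k, n, q', hq', fun N' hN' S x hx => ?_⟩
  obtain ⟨y, hy, hyx⟩ := hgen (N'.map f) (fun i => ⟨q' i, hN' i, hqq' i⟩) S ⟨x, hx, rfl⟩
  rwa [← hf S hyx]

/-- A noetherian submodule of `M`: all submodules of `M` that it contains are finitely
generated. -/
def SubMod.IsNoeth {M : Mod A} (R : SubMod M) : Prop :=
  ∀ R' : SubMod M, (∀ S, R'.carrier S ≤ R.carrier S) → R'.FG

lemma SubMod.isNoeth_closure (hA : A.NoetherianModules) {M : Mod A} {k : ℕ} {n : Fin k → ℕ}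
    (q : ∀ i, M.obj (FinSetCategory.std (n i))) : (SubMod.closure M q).IsNoeth := by
  have hfg : (SubMod.closure M q).toMod.FG := by
    refine ⟨k, n, fun i => ⟨q i, SubMod.mem_closure q i⟩, fun _ => trivial, fun N' hN' S x _ => ?_⟩
    obtain ⟨y, hy, hyx⟩ := SubMod.closure_le q (N'.map (SubMod.closure M q).incl)
      (fun i => ⟨_, hN' i, rfl⟩) S x.2
    rwa [← show y = x from Subtype.ext hyx]
  intro R' hR'
  exact SubMod.FG.of_comap (SubMod.closure M q).incl R'
    (fun S x hx => ⟨⟨x, hR' S hx⟩, rfl⟩) (hA _ hfg _)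

/-- Over an algebra with noetherian module category, a finitely generated submodule of a quotient
is covered by a noetherian submodule: lift the generators. -/
lemma SubMod.FG.exists_isNoeth_le_map (hA : A.NoetherianModules) {M N : Mod A} (f : Mod.Hom M N)
    (hf : ∀ S, Function.Surjective (f.app S)) {R : SubMod N} (hR : R.FG) :
    ∃ W : SubMod M, W.IsNoeth ∧ ∀ S, R.carrier S ≤ (W.map f).carrier S := by
  obtain ⟨k, n, q, -, hgen⟩ := hR
  choose y hy using fun i => hf _ (q i)
  exact ⟨SubMod.closure M y, SubMod.isNoeth_closure hA y,
    hgen _ fun i => ⟨y i, SubMod.mem_closure y i, hy i⟩⟩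

end Ungraded

/-! ### The submodule `𝔪M` -/

variable [Field K] {A : Alg C K} {𝒜 : StandardGrading A}

lemma StandardGrading.map_mem_maxIdeal (𝒜 : StandardGrading A) {S T : C} (ε : S ⟶ T)
    {a : A.obj S} (ha : a ∈ 𝒜.maxIdeal S) : A.map ε a ∈ 𝒜.maxIdeal T := by
  have : 𝒜.maxIdeal S ≤ (𝒜.maxIdeal T).comap (A.map ε) := by
    refine Ideal.span_le.2 ?_
    rintro a ⟨d, hd, ha⟩
    exact Ideal.subset_span ⟨d, hd, 𝒜.map_mem ε d a ha⟩
  exact this ha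

/-- `A_S = K + 𝔪_S`. -/
lemma StandardGrading.exists_sub_mem_maxIdeal (𝒜 : StandardGrading A) (S : C) (a : A.obj S) :
    ∃ c : K, a - algebraMap K _ c ∈ 𝒜.maxIdeal S := by
  induction a using DirectSum.Decomposition.inductionOn (𝒜.deg S) with
  | zero => exact ⟨0, by simp⟩
  | @homogeneous i a =>
    obtain ⟨a, ha⟩ := a
    rcases lt_trichotomy i 0 with hi | rfl | hi
    · rw [𝒜.deg_neg S i hi, Submodule.mem_bot] at ha
      exact ⟨0, by simp [ha]⟩
    · rw [𝒜.deg_zero S] at ha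
      obtain ⟨c, rfl⟩ := ha
      exact ⟨c, by simp⟩
    · refine ⟨0, ?_⟩
      rw [map_zero, sub_zero]
      exact Ideal.subset_span ⟨i, hi, ha⟩
  | add a b ha hb =>
    obtain ⟨c, hc⟩ := ha
    obtain ⟨d, hd⟩ := hb
    refine ⟨c + d, ?_⟩
    rw [map_add, add_sub_add_comm]
    exact add_mem hc hd

/-- The submodule `𝔪M` of `M`, with values `𝔪_S M_S`. -/
def StandardGrading.rad (𝒜 : StandardGrading A) (M : Mod A) : SubMod M where
  carrier S := 𝒜.maxIdeal S • ⊤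
  map_mem ε x hx := by
    induction hx using Submodule.smul_induction_on' with
    | smul a ha x _ =>
      rw [M.map_smul]
      exact Submodule.smul_mem_smul (𝒜.map_mem_maxIdeal ε ha) trivial
    | add x _ y _ hx hy =>
      rw [_root_.map_add]
      exact add_mem hx hy

lemma Mod.Hom.app_mem_rad {M N : Mod A} (f : Mod.Hom M N) {S : C} {x : M.obj S}
    (hx : x ∈ (𝒜.rad M).carrier S) : f.app S x ∈ (𝒜.rad N).carrier S := by
  have : (𝒜.rad M).carrier S ≤ ((𝒜.rad N).carrier S).comap (f.app S) :=
    Submodule.smul_le.2 fun a ha y _ => by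
      rw [Submodule.mem_comap, LinearMap.map_smul]
      exact Submodule.smul_mem_smul ha trivial
  exact this hx

lemma Mod.Hom.exists_of_mem_rad {M N : Mod A} (f : Mod.Hom M N) {S : C}
    (hf : Function.Surjective (f.app S)) {y : N.obj S}
    (hy : y ∈ (𝒜.rad N).carrier S) : ∃ x ∈ (𝒜.rad M).carrier S, f.app S x = y := by
  have h : y ∈ ((𝒜.rad M).carrier S).map (f.app S) := by
    simp only [StandardGrading.rad] at hy ⊢
    rwa [Submodule.map_smul'', Submodule.map_top, LinearMap.range_eq_top.2 hf]
  exact h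

/-! ### Homogeneous components -/

/-- The projection of `M_S` to its homogeneous component of degree `j`. -/
noncomputable def GrMod.component (M : GrMod 𝒜) (S : C) (j : ℤ) : M.obj S →ₗ[K] M.obj S :=
  (M.deg S j).subtype ∘ₗ DirectSum.component K ℤ (fun i => M.deg S i) j ∘ₗ
    (LinearEquiv.ofBijective (DirectSum.coeLinearMap (M.deg S)) (M.isInternal S)).symm.toLinearMap

lemma GrMod.component_mem (M : GrMod 𝒜) (S : C) (j : ℤ) (x : M.obj S) :
    M.component S j x ∈ M.deg S j :=
  Subtype.property _

lemma GrMod.component_of_mem (M : GrMod 𝒜) {S : C} {i : ℤ} {x : M.obj S} (hx : x ∈ M.deg S i)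
    (j : ℤ) : M.component S j x = if i = j then x else 0 := by
  classical
  have h : (LinearEquiv.ofBijective (DirectSum.coeLinearMap (M.deg S)) (M.isInternal S)).symm x =
      DirectSum.lof K ℤ (fun i => M.deg S i) i ⟨x, hx⟩ := by
    rw [LinearEquiv.symm_apply_eq]
    exact (DirectSum.coeLinearMap_lof (M.deg S) i ⟨x, hx⟩).symm
  simp only [GrMod.component, LinearMap.comp_apply, LinearEquiv.coe_coe, h]
  split_ifs with hij
  · subst hij
    simp [DirectSum.component.lof_self]
  · simp [DirectSum.component.of, hij]

lemma GrMod.component_self (M : GrMod 𝒜) {S : C} {j : ℤ} {x : M.obj S} (hx : x ∈ M.deg S j) :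
    M.component S j x = x := by
  rw [M.component_of_mem hx, if_pos rfl]

@[elab_as_elim]
lemma GrMod.induction_homogeneous (M : GrMod 𝒜) {S : C} {p : M.obj S → Prop} (x : M.obj S)
    (zero : p 0) (homogeneous : ∀ i, ∀ x ∈ M.deg S i, p x)
    (add : ∀ x y, p x → p y → p (x + y)) : p x := by
  have hx : x ∈ ⨆ j, M.deg S j := by
    rw [(M.isInternal S).submodule_iSup_eq_top]; trivial
  exact Submodule.iSup_induction _ (motive := p) hx homogeneous zero add

lemma GrMod.finite_component_ne_zero (M : GrMod 𝒜) {S : C} (x : M.obj S) :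
    {j | M.component S j x ≠ 0}.Finite := by
  induction x using GrMod.induction_homogeneous with
  | zero => simp
  | homogeneous i x hx =>
    refine (Set.finite_singleton i).subset fun j hj => ?_
    by_contra h
    exact hj (by rw [M.component_of_mem hx, if_neg (fun h' => h h'.symm)])
  | add x y hx hy =>
    refine (hx.union hy).subset fun j hj => ?_
    by_contra h
    simp only [Set.mem_union, Set.mem_ofPred_eq, not_or, not_not] at h
    exact hj (by rw [map_add, h.1, h.2, add_zero])

lemma GrMod.component_map (M : GrMod 𝒜) {S T : C} (ε : S ⟶ T) (j : ℤ) (x : M.obj S) :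
    M.component T j (M.map ε x) = M.map ε (M.component S j x) := by
  induction x using GrMod.induction_homogeneous with
  | zero => simp
  | homogeneous i x hx =>
    rw [M.component_of_mem hx, M.component_of_mem (M.map_mem ε i x hx)]
    split_ifs <;> simp
  | add x y hx hy => simp only [map_add, hx, hy]

lemma GrHom.app_component {M N : GrMod 𝒜} (φ : GrHom M N) {S : C} (j : ℤ) (x : M.obj S) :
    φ.app S (M.component S j x) = N.component S j (φ.app S x) := by
  induction x using GrMod.induction_homogeneous with
  | zero => simp
  | homogeneous i x hx =>
    rw [M.component_of_mem hx, N.component_of_mem (φ.map_mem S i x hx)]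
    split_ifs <;> simp
  | add x y hx hy => simp only [map_add, hx, hy]

lemma GrMod.component_mem_rad (M : GrMod 𝒜) {S : C} (j : ℤ) {x : M.obj S}
    (hx : x ∈ (𝒜.rad M.toMod).carrier S) :
    M.component S j x ∈ (𝒜.rad M.toMod).carrier S := by
  have key : ∀ a ∈ 𝒜.maxIdeal S, ∀ y : M.obj S,
      M.component S j (a • y) ∈ (𝒜.rad M.toMod).carrier S := by
    intro a ha
    induction ha using Submodule.span_induction with
    | mem a ha =>
      obtain ⟨d, hd, ha⟩ := ha
      intro y
      induction y using GrMod.induction_homogeneous with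
      | zero => simp
      | homogeneous i y hy =>
        rw [M.component_of_mem (M.smul_mem S d i a y ha hy)]
        split_ifs
        · exact Submodule.smul_mem_smul (Ideal.subset_span ⟨d, hd, ha⟩) trivial
        · exact zero_mem _
      | add y z hy hz =>
        rw [smul_add, map_add]
        exact add_mem hy hz
    | zero => simp
    | add a b _ _ ha hb =>
      intro y
      rw [add_smul, map_add]
      exact add_mem (ha y) (hb y)
    | smul b a _ ha =>
      intro y
      rw [smul_eq_mul, mul_comm, mul_smul]
      exact ha _
  induction hx using Submodule.smul_induction_on' with
  | smul a ha x _ => exact key a ha x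
  | add x _ y _ hx hy =>
    rw [_root_.map_add]
    exact add_mem hx hy

/-! ### Degrees and sizes of a finitely generated subquotient -/

/-- Every morphism `[k] → T` factors through every object `S` of intermediate cardinality. -/
def FinSetCategory.Factorizing (C : Type 1) [Category.{0} C] [FinSetCategory C] : Prop :=
  ∀ {k : ℕ} {S T : C} (f : FinSetCategory.std k ⟶ T), k ≤ FinSetCategory.card S →
    FinSetCategory.card S ≤ FinSetCategory.card T →
    ∃ (g : FinSetCategory.std k ⟶ S) (h : S ⟶ T), g ≫ h = f

/-- The submodule `E` of `M` is finitely generated modulo `𝔪M`. -/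
def SubMod.FGModRad (𝒜 : StandardGrading A) {M : Mod A} (E : SubMod M) : Prop :=
  ∃ (k : ℕ) (n : Fin k → ℕ) (q : ∀ i, M.obj (FinSetCategory.std (n i))),
    (∀ i, q i ∈ E.carrier _) ∧
    ∀ N : SubMod M, (∀ S, (𝒜.rad M).carrier S ≤ N.carrier S) → (∀ i, q i ∈ N.carrier _) →
      ∀ S, E.carrier S ≤ N.carrier S

/-- The elements of `M` whose images over `T` all have their component of degree `j` in `𝔪M`.
Since `A_T = K + 𝔪_T`, this is a submodule, although the elements without component of degree `j`
do not form one. -/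
def GrMod.negligible (M : GrMod 𝒜) (T : C) (j : ℤ) : SubMod M.toMod where
  carrier S :=
    { carrier := {y | ∀ ε : S ⟶ T, M.component T j (M.map ε y) ∈ (𝒜.rad M.toMod).carrier T}
      add_mem' := fun hx hy ε => by
        rw [map_add, map_add]
        exact add_mem (hx ε) (hy ε)
      zero_mem' := fun ε => by simp
      smul_mem' := fun a y hy ε => by
        obtain ⟨c, hc⟩ := 𝒜.exists_sub_mem_maxIdeal T (A.map ε a)
        have h : M.map ε (a • y) =
            (A.map ε a - algebraMap K _ c) • M.map ε y + c • M.map ε y := by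
          rw [M.map_smul, sub_smul, algebraMap_smul, sub_add_cancel]
        rw [h, map_add, LinearMap.map_smul]
        refine add_mem (M.component_mem_rad j (Submodule.smul_mem_smul hc trivial)) ?_
        exact Submodule.smul_of_tower_mem _ c (hy ε) }
  map_mem ε x hx δ := by
    rw [← M.map_comp]
    exact hx _

lemma GrMod.mem_negligible {M : GrMod 𝒜} {S T : C} {j : ℤ} {y : M.obj S} :
    y ∈ (M.negligible T j).carrier S ↔
      ∀ ε : S ⟶ T, M.component T j (M.map ε y) ∈ (𝒜.rad M.toMod).carrier T :=
  Iff.rfl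

lemma GrMod.rad_le_negligible (M : GrMod 𝒜) (T : C) (j : ℤ) (S : C) :
    (𝒜.rad M.toMod).carrier S ≤ (M.negligible T j).carrier S :=
  fun x hx ε => M.component_mem_rad j ((𝒜.rad M.toMod).map_mem ε x hx)

/-- The subquotient `(E + 𝔪M) / 𝔪M` of `M` is nonzero in degree `j` at `S`. -/
def GrMod.HasDegree (M : GrMod 𝒜) (E : SubMod M.toMod) (S : C) (j : ℤ) : Prop :=
  ∃ z ∈ M.deg S j, z ∈ E.carrier S ∧ z ∉ (𝒜.rad M.toMod).carrier S

/-- Only the degrees of the components of the generators occur, and beyond the sizes of the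
generators a degree that has disappeared does not come back. -/
lemma SubMod.FGModRad.exists_degrees (hC : FinSetCategory.Factorizing C) {M : GrMod 𝒜}
    {E : SubMod M.toMod} (hE : E.FGModRad 𝒜)
    (hom : ∀ S j, ∀ x ∈ E.carrier S, M.component S j x ∈ E.carrier S) :
    ∃ (D : Finset ℤ) (n₀ : ℕ), (∀ S j, M.HasDegree E S j → j ∈ D) ∧
      ∀ S T j, n₀ ≤ FinSetCategory.card S → FinSetCategory.card S ≤ FinSetCategory.card T →
        M.HasDegree E T j → M.HasDegree E S j := by
  classical
  obtain ⟨k, n, q, hq, hgen⟩ := hE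
  have key : ∀ T j, (∀ i, q i ∈ (M.negligible T j).carrier _) → ¬ M.HasDegree E T j := by
    rintro T j h ⟨z, hz, hzE, hzr⟩
    have := GrMod.mem_negligible.1 (hgen _ (M.rad_le_negligible T j) h T hzE) (𝟙 T)
    rw [M.map_id, M.component_self hz] at this
    exact hzr this
  refine ⟨Finset.univ.biUnion fun i => (M.finite_component_ne_zero (q i)).toFinset,
    Finset.univ.sup n, fun S j hS => ?_, fun S T j hS hST hT => ?_⟩
  · by_contra hj
    simp only [Finset.mem_biUnion, Finset.mem_univ, true_and, Set.Finite.mem_toFinset,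
      Set.mem_ofPred_eq, not_exists, not_not] at hj
    refine key S j (fun i ε => ?_) hS
    rw [M.component_map, hj, map_zero]
    exact zero_mem _
  · by_contra hS'
    refine key T j (fun i ε => ?_) hT
    obtain ⟨g, h, rfl⟩ := hC ε ((Finset.le_sup (Finset.mem_univ i)).trans hS) hST
    rw [M.map_comp, M.component_map]
    refine (𝒜.rad M.toMod).map_mem h _ ?_
    by_contra hr
    exact hS' ⟨_, M.component_mem S j _, hom S j _ (E.map_mem g _ (hq i)), hr⟩

/-! ### Syzygies are finitely generated up to projective modules -/

/-- A morphism that takes values in the image of an injective morphism factors through it. -/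
lemma Mod.Hom.exists_factor {Z F P : Mod A} (ι : Mod.Hom Z F)
    (hι : ∀ S, Function.Injective (ι.app S)) (f : Mod.Hom P F)
    (h : ∀ S x, f.app S x ∈ LinearMap.range (ι.app S)) :
    ∃ g : Mod.Hom P Z, ∀ S x, ι.app S (g.app S x) = f.app S x := by
  have hg : ∀ S x, ι.app S ((LinearEquiv.ofInjective (ι.app S) (hι S)).symm
      (LinearMap.codRestrict _ (f.app S) (h S) x)) = f.app S x := fun S x =>
    congrArg Subtype.val (LinearEquiv.apply_symm_apply (LinearEquiv.ofInjective (ι.app S) (hι S))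
      (LinearMap.codRestrict _ (f.app S) (h S) x))
  refine ⟨⟨fun S => (LinearEquiv.ofInjective (ι.app S) (hι S)).symm.toLinearMap ∘ₗ
    LinearMap.codRestrict _ (f.app S) (h S), fun {S T} ε x => hι T ?_⟩, hg⟩
  rw [ι.naturality]
  exact (hg T _).trans ((f.naturality ε x).trans (congrArg _ (hg S x).symm))

/-- The identity morphism. -/
def Mod.Hom.id (M : Mod A) : Mod.Hom M M where
  app _ := LinearMap.id
  naturality _ _ := rfl

/-- The zero morphism. -/
def Mod.Hom.zero (M N : Mod A) : Mod.Hom M N where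
  app _ := 0
  naturality _ _ := (map_zero _).symm

/-- The difference of two morphisms. -/
def Mod.Hom.sub {M N : Mod A} (f g : Mod.Hom M N) : Mod.Hom M N where
  app S := f.app S - g.app S
  naturality ε x := by simp [f.naturality, g.naturality]

/-- Projective modules. The image of the lift is required to lie in a given submodule `W` that
maps onto the image of `φ`; this is the usual lifting property for `W → g(W)`. -/
def Mod.IsProjective (F : Mod A) : Prop :=
  ∀ (L P : Mod A) (φ : Mod.Hom F P) (g : Mod.Hom L P) (W : SubMod L),
    (∀ S x, φ.app S x ∈ (W.map g).carrier S) →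
    ∃ ψ : Mod.Hom F L, (∀ S x, ψ.app S x ∈ W.carrier S) ∧
      ∀ S x, g.app S (ψ.app S x) = φ.app S x

/-- The target of `π : F → N` is finitely generated up to `F`: the identity of `N` is the sum of
an endomorphism `θ` with values in a noetherian submodule and of a morphism that factors
through `π`. -/
def Mod.Hom.StablyNoeth {F N : Mod A} (π : Mod.Hom F N) : Prop :=
  ∃ (R : SubMod N) (θ : Mod.Hom N N) (χ : Mod.Hom N F),
    R.IsNoeth ∧ (∀ S x, θ.app S x ∈ R.carrier S) ∧
    ∀ S x, θ.app S x + π.app S (χ.app S x) = x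

lemma Mod.Hom.stablyNoeth_of_fg (hA : A.NoetherianModules) {F N : Mod A} (π : Mod.Hom F N)
    (hN : N.FG) : π.StablyNoeth :=
  ⟨SubMod.top N, Mod.Hom.id N, Mod.Hom.zero N F, fun R' _ => hA _ hN R', fun _ _ => trivial,
    fun S x => by simp [Mod.Hom.id, Mod.Hom.zero]⟩

/-- Let `0 → Z → F → N → 0` be exact with `F` projective. The endomorphism `θ` of `N` lifts to `F`
and restricts to `Z`; there it differs from the identity by the restriction of a morphism
`F → Z`, because the identity of `F` and the lift of `θ` agree up to `Z` and a morphism that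
factors through `N`. -/
lemma Mod.Hom.StablyNoeth.exists_ker (hA : A.NoetherianModules) {Z F N : Mod A}
    {ι : Mod.Hom Z F} {π : Mod.Hom F N} (hF : F.IsProjective)
    (hι : ∀ S, Function.Injective (ι.app S)) (hπ : ∀ S, Function.Surjective (π.app S))
    (hex : ∀ S, Function.Exact (ι.app S) (π.app S)) (hN : π.StablyNoeth) :
    ∃ (W : SubMod F) (θ : Mod.Hom Z Z) (h : Mod.Hom F Z),
      W.IsNoeth ∧ (∀ S x, ι.app S (θ.app S x) ∈ W.carrier S) ∧
      ∀ S x, θ.app S x + h.app S (ι.app S x) = x := by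
  obtain ⟨R, θ, χ, hR, hθ, hχ⟩ := hN
  obtain ⟨W, hW, hRW⟩ := (hR R fun _ => le_rfl).exists_isNoeth_le_map hA π hπ
  obtain ⟨θ₀, hθ₀W, hθ₀⟩ := hF _ _ (θ.comp π) π W fun S x => hRW S (hθ S _)
  replace hθ₀ : ∀ S x, π.app S (θ₀.app S x) = θ.app S (π.app S x) := hθ₀
  have hπι : ∀ S x, π.app S (ι.app S x) = 0 := fun S => (hex S).apply_apply_eq_zero
  obtain ⟨θ₁, hθ₁⟩ := ι.exists_factor hι (θ₀.comp ι) fun S x => (hex S _).1 (by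
    simp [Mod.Hom.comp, hθ₀, hπι])
  obtain ⟨h, hh⟩ := ι.exists_factor hι (((Mod.Hom.id F).sub θ₀).sub (χ.comp π))
    fun S x => (hex S _).1 (by
      have := hχ S (π.app S x)
      simp only [Mod.Hom.sub, Mod.Hom.id, Mod.Hom.comp, LinearMap.sub_apply, LinearMap.id_apply,
        LinearMap.comp_apply, map_sub, hθ₀]
      rw [sub_sub, this, sub_self])
  refine ⟨W, θ₁, h, hW, fun S x => ?_, fun S x => hι S ?_⟩
  · rw [hθ₁]
    exact hθ₀W S _
  · rw [map_add, hθ₁, hh]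
    simp [Mod.Hom.sub, Mod.Hom.id, Mod.Hom.comp, hπι]

lemma Mod.Hom.StablyNoeth.ker (hA : A.NoetherianModules) {F' Z F N : Mod A}
    {π' : Mod.Hom F' Z} {ι : Mod.Hom Z F} {π : Mod.Hom F N} (hF : F.IsProjective)
    (hι : ∀ S, Function.Injective (ι.app S)) (hπ : ∀ S, Function.Surjective (π.app S))
    (hπ' : ∀ S, Function.Surjective (π'.app S))
    (hex : ∀ S, Function.Exact (ι.app S) (π.app S)) (hN : π.StablyNoeth) :
    π'.StablyNoeth := by
  obtain ⟨W, θ, h, hW, hθ, hh⟩ := hN.exists_ker hA hF hι hπ hex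
  obtain ⟨ψ, -, hψ⟩ := hF _ _ h π' (SubMod.top _) fun S x =>
    (hπ' S (h.app S x)).imp fun _ hy => ⟨trivial, hy⟩
  refine ⟨W.comap ι, θ, ψ.comp ι, fun R' hR' => SubMod.FG.of_map ι hι R' (hW _ ?_), hθ,
    fun S x => ?_⟩
  · rintro S _ ⟨x, hx, rfl⟩
    exact hR' S hx
  · simp only [Mod.Hom.comp, LinearMap.comp_apply, hψ, hh]

/-- For `0 → Z → F → N → 0` exact with `F` projective, the submodule `Z ∩ 𝔪F` of `Z`, whose
quotient `(Z ∩ 𝔪F) / 𝔪Z` is `Tor_1(N, 𝐊)`, is finitely generated modulo `𝔪Z`. -/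
lemma Mod.Hom.StablyNoeth.fgModRad (hA : A.NoetherianModules) {Z F N : Mod A}
    {ι : Mod.Hom Z F} {π : Mod.Hom F N} (hF : F.IsProjective)
    (hι : ∀ S, Function.Injective (ι.app S)) (hπ : ∀ S, Function.Surjective (π.app S))
    (hex : ∀ S, Function.Exact (ι.app S) (π.app S)) (hN : π.StablyNoeth) :
    ((𝒜.rad F).comap ι).FGModRad 𝒜 := by
  obtain ⟨W, θ, h, hW, hθ, hh⟩ := hN.exists_ker hA hF hι hπ hex
  obtain ⟨k, n, q, hq, hgen⟩ : ((W.comap ι).inter ((𝒜.rad F).comap ι)).FG := by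
    refine SubMod.FG.of_map ι hι _ (hW _ ?_)
    rintro S _ ⟨x, hx, rfl⟩
    exact hx.1
  refine ⟨k, n, q, fun i => (hq i).2, fun N hN hqN S x hx => ?_⟩
  -- On `Z ∩ 𝔪F` the morphism `h` takes values in `𝔪Z`.
  have hhx : h.app S (ι.app S x) ∈ (𝒜.rad Z).carrier S := h.app_mem_rad hx
  have hθx : θ.app S x ∈ ((𝒜.rad F).comap ι).carrier S := by
    rw [eq_sub_of_add_eq (hh S x)]
    exact sub_mem hx (ι.app_mem_rad hhx)
  rw [← hh S x]
  exact add_mem (hgen N hqN S ⟨hθ S x, hθx⟩) (hN S hhx)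

/-! ### The free covers -/

/-- A morphism of graded modules, with the grading forgotten. -/
def GrHom.toHom {M N : GrMod 𝒜} (φ : GrHom M N) : Mod.Hom M.toMod N.toMod where
  app := φ.app
  naturality := φ.naturality

/-- The inclusion of the kernel of a morphism of graded modules. -/
noncomputable def GrHom.kerIncl {M N : GrMod 𝒜} (φ : GrHom M N) : GrHom φ.ker M where
  app S := (LinearMap.ker (φ.app S)).subtype
  naturality _ _ := rfl
  map_mem _ _ _ hx := hx

lemma GrHom.kerIncl_injective {M N : GrMod 𝒜} (φ : GrHom M N) (S : C) :
    Function.Injective (φ.kerIncl.app S) :=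
  Subtype.val_injective

lemma GrHom.kerIncl_exact {M N : GrMod 𝒜} (φ : GrHom M N) (S : C) :
    Function.Exact (φ.kerIncl.app S) (φ.app S) :=
  LinearMap.exact_subtype_ker_map (φ.app S)

lemma GrMod.freeCover_isProjective (M : GrMod 𝒜) : M.freeCover.toMod.IsProjective := by
  intro L P φ g W h
  let e : ∀ l : M.Index, M.freeCover.obj (FinSetCategory.std l.1) := fun l =>
    (Finsupp.single (⟨l, 𝟙 _⟩ : M.BasisIndex _) (1 : A.obj _))
  choose y hyW hy using fun l : M.Index => h _ (e l)
  let Ψ : ∀ S, (M.BasisIndex S →₀ A.obj S) →ₗ[A.obj S] L.obj S := fun S =>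
    Finsupp.linearCombination (A.obj S) fun b : M.BasisIndex S => L.map b.2 (y b.1)
  have hΨ : ∀ S b a, Ψ S (Finsupp.single b a) = a • L.map b.2 (y b.1) :=
    fun S b a => Finsupp.linearCombination_single _ _ _
  have hnat : ∀ {S T : C} (ε : S ⟶ T) (x : M.BasisIndex S →₀ A.obj S),
      Ψ T (M.freeMap ε x) = L.map ε (Ψ S x) := by
    intro S T ε x
    induction x using Finsupp.induction_linear with
    | zero => rw [map_zero, map_zero, map_zero, map_zero]
    | add f g hf hg => simp only [map_add, hf, hg]
    | single b a => rw [M.freeMap_single, hΨ, hΨ, L.map_smul, L.map_comp]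
  have hsingle : ∀ S (b : M.BasisIndex S) (a : A.obj S),
      (Finsupp.single b a : M.freeCover.obj S) = a • M.freeCover.map b.2 (e b.1) := by
    intro S b a
    change _ = a • M.freeMap b.2 (Finsupp.single _ _)
    rw [M.freeMap_single]
    simp
  have hφ : ∀ S (x : M.BasisIndex S →₀ A.obj S), g.app S (Ψ S x) = φ.app S x := by
    intro S x
    induction x using Finsupp.induction_linear with
    | zero => rw [map_zero, map_zero]; exact (map_zero (φ.app S)).symm
    | add f f' hf hf' =>
      rw [map_add, map_add, hf, hf']; exact (map_add (φ.app S) f f').symm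
    | single b a =>
      rw [hΨ, LinearMap.map_smul, g.naturality, hy, ← φ.naturality, ← LinearMap.map_smul, hsingle]
  refine ⟨⟨Ψ, hnat⟩, fun S x => ?_, hφ⟩
  change Ψ S x ∈ _
  induction x using Finsupp.induction_linear with
  | zero => rw [map_zero]; exact zero_mem _
  | add f g hf hg => rw [map_add]; exact add_mem hf hg
  | single b a =>
    rw [hΨ]
    exact Submodule.smul_mem _ _ (W.map_mem _ _ (hyW _))

lemma GrMod.stablyNoeth_syz (hA : A.NoetherianModules) {M : GrMod 𝒜} (hM : M.toMod.FG) (p : ℕ) :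
    (M.syz p).coverMap.toHom.StablyNoeth := by
  induction p with
  | zero => exact Mod.Hom.stablyNoeth_of_fg hA _ hM
  | succ p ih =>
    exact ih.ker (ι := (M.syz p).coverMap.kerIncl.toHom) (π := (M.syz p).coverMap.toHom) hA
      (M.syz p).freeCover_isProjective
      (M.syz p).coverMap.kerIncl_injective (M.syz p).coverApp_surjective
      (M.syz (p + 1)).coverApp_surjective (M.syz p).coverMap.kerIncl_exact

/-- The elements of the `p`-th syzygy module whose classes modulo `𝔪` are the elements of
`Tor_p(M, 𝐊)`: all of `M` for `p = 0`, and those lying in `𝔪F_p` for the `(p + 1)`-st syzygy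
module, which is contained in the free module `F_p`. -/
noncomputable def GrMod.torSub (M : GrMod 𝒜) : ∀ p, SubMod (M.syz p).toMod
  | 0 => SubMod.top _
  | p + 1 => (𝒜.rad (M.syz p).freeCover.toMod).comap (M.syz p).coverMap.kerIncl.toHom

lemma GrMod.torSub_fgModRad (hA : A.NoetherianModules) {M : GrMod 𝒜} (hM : M.toMod.FG) (p : ℕ) :
    (M.torSub p).FGModRad 𝒜 := by
  cases p with
  | zero =>
    obtain ⟨k, n, q, hq, hgen⟩ := hM
    exact ⟨k, n, q, hq, fun N _ => hgen N⟩
  | succ p =>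
    exact (GrMod.stablyNoeth_syz hA hM p).fgModRad (π := (M.syz p).coverMap.toHom) hA
      (M.syz p).freeCover_isProjective (M.syz p).coverMap.kerIncl_injective (M.syz p).coverApp_surjective
      (M.syz p).coverMap.kerIncl_exact

lemma GrMod.component_mem_torSub (M : GrMod 𝒜) (p : ℕ) (S : C) (j : ℤ) (x : (M.syz p).obj S)
    (hx : x ∈ (M.torSub p).carrier S) : (M.syz p).component S j x ∈ (M.torSub p).carrier S := by
  cases p with
  | zero => trivial
  | succ p =>
    have h : (M.syz p).coverMap.kerIncl.app S ((M.syz (p + 1)).component S j x) =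
      (M.syz p).freeCover.component S j ((M.syz p).coverMap.kerIncl.app S x) :=
      (M.syz p).coverMap.kerIncl.app_component j x
    change (M.syz p).coverMap.kerIncl.app S ((M.syz (p + 1)).component S j x) ∈
      (𝒜.rad (M.syz p).freeCover.toMod).carrier S
    rw [h]
    exact GrMod.component_mem_rad _ j hx

/-! ### Betti numbers and syzygies -/

lemma tmul_one_eq_zero_iff {R N : Type*} [CommRing R] [AddCommGroup N] [Module R N]
    (I : Ideal R) (x : N) : x ⊗ₜ[R] (1 : R ⧸ I) = 0 ↔ x ∈ (I • ⊤ : Submodule R N) := by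
  rw [← (TensorProduct.tensorQuotEquivQuotSMul N I).map_eq_zero_iff,
    ← map_one (Ideal.Quotient.mk I), TensorProduct.tensorQuotEquivQuotSMul_tmul_mk, one_smul]
  exact Submodule.Quotient.mk_eq_zero _

lemma exists_eq_tmul_one {R N : Type*} [CommRing R] [AddCommGroup N] [Module R N]
    (I : Ideal R) (z : N ⊗[R] (R ⧸ I)) : ∃ x : N, z = x ⊗ₜ[R] (1 : R ⧸ I) := by
  induction z using TensorProduct.induction_on with
  | zero => exact ⟨0, by simp⟩
  | tmul x y =>
    obtain ⟨a, rfl⟩ := Ideal.Quotient.mk_surjective y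
    refine ⟨a • x, ?_⟩
    rw [TensorProduct.smul_tmul, ← map_one (Ideal.Quotient.mk I), ← Ideal.Quotient.mk_eq_mk,
      ← Ideal.Quotient.mk_eq_mk, ← Submodule.Quotient.mk_smul, smul_eq_mul, mul_one]
  | add z w hz hw =>
    obtain ⟨x, rfl⟩ := hz
    obtain ⟨y, rfl⟩ := hw
    exact ⟨x + y, (TensorProduct.add_tmul _ _ _).symm⟩

/-- The degree `j` part of `F_S ⊗ A_S / 𝔪_S` consists of the classes of the elements of degree `j`,
since `A_S / 𝔪_S` is generated by `1` over `K`. -/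
lemma GrMod.mem_redDeg_iff (F : GrMod 𝒜) {S : C} {j : ℤ} {z : F.red S} :
    z ∈ F.redDeg S j ↔ ∃ x ∈ F.deg S j, z = x ⊗ₜ[A.obj S] (1 : 𝒜.residue S) := by
  refine ⟨fun hz => ?_, fun ⟨x, hx, hz⟩ => Submodule.subset_span ⟨x, hx, 1, hz⟩⟩
  induction hz using Submodule.span_induction with
  | mem z hz =>
    obtain ⟨x, hx, y, rfl⟩ := hz
    obtain ⟨a, rfl⟩ := Ideal.Quotient.mk_surjective y
    obtain ⟨c, hc⟩ := 𝒜.exists_sub_mem_maxIdeal S a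
    refine ⟨c • x, Submodule.smul_mem _ c hx, ?_⟩
    rw [(Ideal.Quotient.eq (I := 𝒜.maxIdeal S)).2 hc, ← algebraMap_smul (A.obj S) c x,
      TensorProduct.smul_tmul, ← map_one (Ideal.Quotient.mk (𝒜.maxIdeal S)),
      ← Ideal.Quotient.mk_eq_mk, ← Ideal.Quotient.mk_eq_mk, ← Submodule.Quotient.mk_smul,
      smul_eq_mul, mul_one]
  | zero => exact ⟨0, zero_mem _, by simp⟩
  | add z w _ _ hz hw =>
    obtain ⟨x, hx, rfl⟩ := hz
    obtain ⟨y, hy, rfl⟩ := hw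
    exact ⟨x + y, add_mem hx hy, (TensorProduct.add_tmul _ _ _).symm⟩
  | smul c z _ hz =>
    obtain ⟨x, hx, rfl⟩ := hz
    exact ⟨c • x, Submodule.smul_mem _ c hx, (TensorProduct.smul_tmul' _ _ _).symm⟩

lemma GrResolution.rank_torDeg_ne_zero_iff {M : GrMod 𝒜} (F : GrResolution M) {S : C} {p : ℕ}
    {j : ℤ} : Module.rank K (F.torDeg S p j) ≠ 0 ↔
      ∃ x ∈ (F.F p).deg S j, x ⊗ₜ[A.obj S] (1 : 𝒜.residue S) ∈ F.cycles S p ∧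
        x ⊗ₜ[A.obj S] (1 : 𝒜.residue S) ∉ F.boundaries S p := by
  rw [Ne, Submodule.rank_eq_zero, ← Ne, Submodule.ne_bot_iff]
  constructor
  · rintro ⟨_, ⟨⟨z, hz⟩, hzd, rfl⟩, hne⟩
    obtain ⟨x, hx, rfl⟩ := (GrMod.mem_redDeg_iff _).1 hzd
    exact ⟨x, hx, hz, fun hb => hne ((Submodule.Quotient.mk_eq_zero _).2 hb)⟩
  · rintro ⟨x, hx, hz, hb⟩
    refine ⟨_, ⟨⟨_, hz⟩, (GrMod.mem_redDeg_iff _).2 ⟨x, hx, rfl⟩, rfl⟩, fun h => hb ?_⟩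
    have h' : (⟨_, hz⟩ : F.cycles S p) ∈ (F.boundaries S p).comap (F.cycles S p).subtype :=
      (Submodule.Quotient.mk_eq_zero _).1 h
    exact h'

lemma GrHom.exists_homogeneous {M N : GrMod 𝒜} (φ : GrHom M N) {S : C}
    (hφ : Function.Surjective (φ.app S)) {j : ℤ} {y : N.obj S} (hy : y ∈ N.deg S j) :
    ∃ x ∈ M.deg S j, φ.app S x = y := by
  obtain ⟨x, rfl⟩ := hφ y
  exact ⟨M.component S j x, M.component_mem S j x, by rw [φ.app_component, N.component_self hy]⟩

lemma GrResolution.tmul_one_mem_boundaries_iff {M : GrMod 𝒜} (F : GrResolution M) {S : C} {p : ℕ}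
    (x : (F.F p).obj S) :
    x ⊗ₜ[A.obj S] (1 : 𝒜.residue S) ∈ F.boundaries S p ↔
      ∃ w, x - (F.d p).app S w ∈ (𝒜.rad (F.F p).toMod).carrier S := by
  have h : ∀ w, x - (F.d p).app S w ∈ (𝒜.rad (F.F p).toMod).carrier S ↔
      ((F.d p).app S).rTensor (𝒜.residue S) (w ⊗ₜ[A.obj S] (1 : 𝒜.residue S)) =
        x ⊗ₜ[A.obj S] (1 : 𝒜.residue S) := fun w => by
    rw [LinearMap.rTensor_tmul, eq_comm, ← sub_eq_zero, ← TensorProduct.sub_tmul]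
    exact (tmul_one_eq_zero_iff _ _).symm
  constructor
  · rintro ⟨z, hz⟩
    obtain ⟨w, rfl⟩ := exists_eq_tmul_one _ z
    exact ⟨w, (h w).2 hz⟩
  · rintro ⟨w, hw⟩
    exact ⟨_, (h w).1 hw⟩

lemma GrResolution.tmul_one_mem_cycles_succ_iff {M : GrMod 𝒜} (F : GrResolution M) {S : C}
    {p : ℕ} (x : (F.F (p + 1)).obj S) :
    x ⊗ₜ[A.obj S] (1 : 𝒜.residue S) ∈ F.cycles S (p + 1) ↔
      (F.d p).app S x ∈ (𝒜.rad (F.F p).toMod).carrier S := by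
  change ((F.d p).app S).rTensor (𝒜.residue S) (x ⊗ₜ 1) = 0 ↔ _
  rw [LinearMap.rTensor_tmul]
  exact tmul_one_eq_zero_iff _ _

/-- In the resolution by free covers, an element of `F_p` is a boundary modulo `𝔪F_p` if and only
if its image in the `p`-th syzygy module `Z` lies in `𝔪Z`. -/
lemma GrMod.tmul_one_mem_boundaries_iff (M : GrMod 𝒜) {S : C} {p : ℕ}
    (x : (M.resolution.F p).obj S) :
    x ⊗ₜ[A.obj S] (1 : 𝒜.residue S) ∈ M.resolution.boundaries S p ↔
      (M.syz p).coverMap.app S x ∈ (𝒜.rad (M.syz p).toMod).carrier S := by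
  have hd : ∀ w, (M.syz p).coverMap.app S ((M.resolution.d p).app S w) = 0 :=
    fun w => ((M.syz (p + 1)).coverApp S w).2
  rw [GrResolution.tmul_one_mem_boundaries_iff]
  constructor
  · rintro ⟨w, hw⟩
    have h := (M.syz p).coverMap.toHom.app_mem_rad hw
    have h' : (M.syz p).coverMap.toHom.app S (x - (M.resolution.d p).app S w) =
        (M.syz p).coverMap.app S x :=
      (map_sub ((M.syz p).coverMap.app S) _ _).trans (by rw [hd, sub_zero])
    rwa [h'] at h
  · intro h
    obtain ⟨y, hy, hyx⟩ : ∃ y ∈ (𝒜.rad (M.resolution.F p).toMod).carrier S,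
        (M.syz p).coverMap.app S y = (M.syz p).coverMap.app S x :=
      (M.syz p).coverMap.toHom.exists_of_mem_rad ((M.syz p).coverApp_surjective S) h
    have hker : x - y ∈ LinearMap.ker ((M.syz p).coverMap.app S) :=
      (map_sub ((M.syz p).coverMap.app S) x y).trans (sub_eq_zero.2 hyx.symm)
    obtain ⟨w, hw⟩ := (M.syz (p + 1)).coverApp_surjective S ⟨x - y, hker⟩
    have hdw : (M.resolution.d p).app S w = x - y := congrArg Subtype.val hw
    refine ⟨w, ?_⟩
    rw [hdw, sub_sub_cancel]
    exact hy

lemma GrMod.tmul_one_mem_cycles_iff (M : GrMod 𝒜) {S : C} {p : ℕ}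
    (x : (M.resolution.F p).obj S) :
    x ⊗ₜ[A.obj S] (1 : 𝒜.residue S) ∈ M.resolution.cycles S p ↔
      (M.syz p).coverMap.app S x ∈ (M.torSub p).carrier S := by
  cases p with
  | zero => exact ⟨fun _ => trivial, fun _ => trivial⟩
  | succ p => exact M.resolution.tmul_one_mem_cycles_succ_iff x

lemma GrMod.gradedBetti_ne_zero_iff (M : GrMod 𝒜) (S : C) (p : ℕ) (j : ℤ) :
    M.gradedBetti S p j ≠ 0 ↔ (M.syz p).HasDegree (M.torSub p) S j := by
  refine M.resolution.rank_torDeg_ne_zero_iff.trans ⟨?_, ?_⟩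
  · rintro ⟨x, hx, hc, hb⟩
    exact ⟨_, (M.syz p).coverMap.map_mem S j x hx, (M.tmul_one_mem_cycles_iff x).1 hc,
      fun h => hb ((M.tmul_one_mem_boundaries_iff x).2 h)⟩
  · rintro ⟨z, hz, hE, hr⟩
    obtain ⟨x, hx, rfl⟩ := (M.syz p).coverMap.exists_homogeneous
      ((M.syz p).coverApp_surjective S) hz
    exact ⟨x, hx, (M.tmul_one_mem_cycles_iff x).2 hE,
      fun h => hr ((M.tmul_one_mem_boundaries_iff x).1 h)⟩

/-! ### Stabilization -/

lemma GrMod.exists_stable_degrees (hC : FinSetCategory.Factorizing C) (hA : A.NoetherianModules)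
    (M : GrMod 𝒜) (hM : M.toMod.FG) (p : ℕ) :
    ∃ m : ℤ,
      ({j : ℤ | ∃ S : C, M.gradedBetti S p j ≠ 0}.Nonempty →
        IsGreatest {j : ℤ | ∃ S : C, M.gradedBetti S p j ≠ 0} m) ∧
      BddBelow {j : ℤ | ∃ S : C, M.gradedBetti S p j ≠ 0} ∧
      ∃ J : Finset ℤ, (∀ j ∈ J, j ≤ m) ∧
        ∃ n : ℕ, ∀ S : C, n ≤ FinSetCategory.card S →
          ∀ j : ℤ, M.gradedBetti S p j ≠ 0 ↔ j ∈ J := by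
  classical
  obtain ⟨D, n₀, hD, hmono⟩ :=
    (M.torSub_fgModRad hA hM p).exists_degrees hC (M.component_mem_torSub p)
  simp only [GrMod.gradedBetti_ne_zero_iff]
  set P := (M.syz p).HasDegree (M.torSub p)
  have hfin : {j : ℤ | ∃ S : C, P S j}.Finite :=
    D.finite_toSet.subset fun j ⟨S, hS⟩ => hD S j hS
  obtain ⟨m, hm⟩ : ∃ m : ℤ, {j : ℤ | ∃ S : C, P S j}.Nonempty →
      IsGreatest {j : ℤ | ∃ S : C, P S j} m := by
    by_cases hne : {j : ℤ | ∃ S : C, P S j}.Nonempty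
    · obtain ⟨m, hm, hmax⟩ := Set.exists_max_image _ id hfin hne
      exact ⟨m, fun _ => ⟨hm, hmax⟩⟩
    · exact ⟨0, fun h => absurd h hne⟩
  -- From size `N j` on, whether the degree `j` occurs at `S` does not depend on `S`.
  have hev : ∀ j, ∃ N, ∀ S : C, N ≤ FinSetCategory.card S →
      (P S j ↔ ∀ T : C, n₀ ≤ FinSetCategory.card T → P T j) := by
    intro j
    by_cases h : ∀ T : C, n₀ ≤ FinSetCategory.card T → P T j
    · exact ⟨n₀, fun S hS => ⟨fun _ => h, fun _ => h S hS⟩⟩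
    · obtain ⟨T, hT, hTj⟩ : ∃ T : C, n₀ ≤ FinSetCategory.card T ∧ ¬ P T j := by
        simpa using h
      exact ⟨FinSetCategory.card T, fun S hS =>
        ⟨fun hSj => absurd (hmono T S j hT hS hSj) hTj, fun h' => absurd h' h⟩⟩
  choose N hN using hev
  -- The condition `∃ S, P S j` gives `j ≤ m` without an object of size at least `n₀`.
  refine ⟨m, hm, hfin.bddBelow, D.filter fun j => ∃ S : C, P S j ∧ ∀ T : C,
    n₀ ≤ FinSetCategory.card T → P T j, fun j hj => ?_, D.sup N, fun S hS j => ?_⟩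
  · obtain ⟨-, S, hSj, -⟩ := Finset.mem_filter.1 hj
    exact (hm ⟨j, S, hSj⟩).2 ⟨S, hSj⟩
  · rw [Finset.mem_filter]
    refine ⟨fun h => ⟨hD S j h, S, h, (hN j S ((Finset.le_sup (hD S j h)).trans hS)).1 h⟩, ?_⟩
    rintro ⟨hjD, -, -, h⟩
    exact (hN j S ((Finset.le_sup hjD).trans hS)).2 h

/-! ### Factorizations in `FI` and `OI` -/

/-- The image of a map from a set with `k` elements is contained in a subset of any cardinality
between `k` and that of the target. -/
lemma exists_range_subset_card_eq {k c : ℕ} {T : Type} [Finite T] (f : Fin k → T) (hk : k ≤ c)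
    (hc : c ≤ Nat.card T) : ∃ U : Finset T, U.card = c ∧ ∀ i, f i ∈ U := by
  classical
  have := Fintype.ofFinite T
  obtain ⟨U, hU, -, hcard⟩ := Finset.exists_subsuperset_card_eq
    (Finset.subset_univ (Finset.univ.image f)) (n := c)
    (Finset.card_image_le.trans (by simpa using hk))
    (by rwa [Finset.card_univ, ← Nat.card_eq_fintype_card])
  exact ⟨U, hcard, fun i => hU (Finset.mem_image_of_mem f (Finset.mem_univ i))⟩

lemma FI.factorizing : FinSetCategory.Factorizing FI := by
  intro k S T f hk hST
  obtain ⟨U, hU, hf⟩ := exists_range_subset_card_eq (T := T.carrier) f.toFun hk hST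
  obtain ⟨e⟩ : Nonempty (U ≃ S.carrier) := by
    rw [← Finite.card_eq, Nat.card_eq_fintype_card, Fintype.card_coe, hU]
    rfl
  refine ⟨⟨fun i => e ⟨f.toFun i, hf i⟩, fun i i' h => ?_⟩,
    e.symm.toEmbedding.trans (Function.Embedding.subtype _), Function.Embedding.ext fun i => ?_⟩
  · exact f.injective (congrArg Subtype.val (e.injective h))
  · change (e.symm (e ⟨f.toFun i, hf i⟩)).1 = _
    rw [e.symm_apply_apply]
    rfl

lemma OI.factorizing : FinSetCategory.Factorizing OI := by
  intro k S T f hk hST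
  obtain ⟨U, hU, hf⟩ := exists_range_subset_card_eq (T := T.carrier) f.toFun hk hST
  have := Fintype.ofFinite S.carrier
  have e : U ≃o S.carrier := (Fintype.orderIsoFinOfCardEq U ((Fintype.card_coe U).trans hU)).symm.trans
    (Fintype.orderIsoFinOfCardEq S.carrier Nat.card_eq_fintype_card.symm)
  refine ⟨RelEmbedding.trans (OrderEmbedding.ofMapLEIff (fun i => (⟨f.toFun i, hf i⟩ : U))
    fun i i' => f.map_rel_iff) e.toOrderEmbedding,
    RelEmbedding.trans e.symm.toOrderEmbedding (OrderEmbedding.subtype _),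
    RelEmbedding.ext fun i => ?_⟩
  change (e.symm (e ⟨f.toFun i, hf i⟩)).1 = _
  rw [e.symm_apply_apply]
  rfl

end FinInj
open FinInj in
theorem mainTheorem6 {K : Type u} [Field K] (p : ℕ) :
    (∀ (A : Alg FI K) (𝒜 : StandardGrading A) (_hA : A.NoetherianModules)
      (M : GrMod 𝒜) (_hM : M.toMod.FG),
      ∃ m : ℤ,
        ({j : ℤ | ∃ S : FI, M.gradedBetti S p j ≠ 0}.Nonempty →
          IsGreatest {j : ℤ | ∃ S : FI, M.gradedBetti S p j ≠ 0} m) ∧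
        BddBelow {j : ℤ | ∃ S : FI, M.gradedBetti S p j ≠ 0} ∧
        ∃ J : Finset ℤ, (∀ j ∈ J, j ≤ m) ∧
          ∃ n : ℕ, ∀ S : FI, n ≤ Nat.card S.carrier →
            ∀ j : ℤ, M.gradedBetti S p j ≠ 0 ↔ j ∈ J) ∧
    (∀ (A : Alg OI K) (𝒜 : StandardGrading A) (_hA : A.NoetherianModules)
      (M : GrMod 𝒜) (_hM : M.toMod.FG),
      ∃ m : ℤ,
        ({j : ℤ | ∃ S : OI, M.gradedBetti S p j ≠ 0}.Nonempty →
          IsGreatest {j : ℤ | ∃ S : OI, M.gradedBetti S p j ≠ 0} m) ∧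
        BddBelow {j : ℤ | ∃ S : OI, M.gradedBetti S p j ≠ 0} ∧
        ∃ J : Finset ℤ, (∀ j ∈ J, j ≤ m) ∧
          ∃ n : ℕ, ∀ S : OI, n ≤ Nat.card S.carrier →
            ∀ j : ℤ, M.gradedBetti S p j ≠ 0 ↔ j ∈ J) :=
  ⟨fun _ _ hA M hM => M.exists_stable_degrees FI.factorizing hA hM p,
    fun _ _ hA M hM => M.exists_stable_degrees OI.factorizing hA hM p⟩
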